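/- Let $\mathfrak H$ be a complex Hilbert space with inner product $(\cdot,\cdot)$, and let $a$ and $b$ be positive, selfadjoint (not necessarily bounded) operators in $\mathfrak H$ such that $\mathrm{dom}\,a^{1/2}\cap\mathrm{dom}\,b^{1/2}$ is dense in $\mathfrak H$. On $\mathrm{ran}\,a$ the formula $\langle ax,ay\rangle_a=(ax,y)$ $(x,y\in\mathrm{dom}\,a)$ defines an inner product; let $\mathfrak H_a$ be the completion of this pre-Hilbert space, and define $\mathfrak H_b$ likewise from $b$. Let $J:\mathfrak H_a\oplus\mathfrak H_b\to\mathfrak H$ be the densely defined operator with $$\mathrm{dom}\,J=\mathrm{ran}\,a\oplus\mathrm{ran}\,b,\qquad J(ax\oplus by)=ax+by\quad(x\in\mathrm{dom}\,a,\ y\in\mathrm{dom}\,b).$$ Let $a\stackrel{.}{+}b$ denote the form sum of $a$ and $b$, i.e. the operator associated with the closed form $q(x,y)=(a^{1/2}x,a^{1/2}y)+(b^{1/2}x,b^{1/2}y)$ on $\mathrm{dom}\,q=\mathrm{dom}\,a^{1/2}\cap\mathrm{dom}\,b^{1/2}$: a vector $x$ belongs to $\mathrm{dom}(a\stackrel{.}{+}b)$,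 with $(a\stackrel{.}{+}b)x=z$, if and only if $x\in\mathrm{dom}\,q$ and $q(x,y)=(z,y)$ for all $y\in\mathrm{dom}\,q$. Then $a\stackrel{.}{+}b$ is a positive, selfadjoint operator, and $$J^{**}J^{*}=a\stackrel{.}{+}b,$$ where $J^{**}J^*$ has its natural domain $\{x\in\mathrm{dom}\,J^*: J^*x\in\mathrm{dom}\,J^{**}\}$. -/

import Mathlib

namespace FormSum

noncomputable section

open scoped ComplexConjugate LinearPMap

variable {H : Type*} [NormedAddCommGroup H] [InnerProductSpace ℂ H]

/-! ### Unbounded operators -/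

/-- The product `g f` of two unbounded operators on its natural domain
`{x ∈ dom f | f x ∈ dom g}`. -/
def opComp {E F G : Type*} [AddCommGroup E] [Module ℂ E] [AddCommGroup F] [Module ℂ F]
    [AddCommGroup G] [Module ℂ G] (g : F →ₗ.[ℂ] G) (f : E →ₗ.[ℂ] F) : E →ₗ.[ℂ] G :=
  g.comp (f.domRestrict ((g.domain.comap f.toFun).map f.domain.subtype)) (by
    intro x
    obtain ⟨y, hy, hyx⟩ := Submodule.mem_map.mp x.2.1
    rw [LinearPMap.domRestrict_apply (x := x) (y := y) hyx.symm]
    exact hy)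

theorem mem_opComp_domain {E F G : Type*} [AddCommGroup E] [Module ℂ E] [AddCommGroup F]
    [Module ℂ F] [AddCommGroup G] [Module ℂ G] (g : F →ₗ.[ℂ] G) (f : E →ₗ.[ℂ] F) (x : E) :
    x ∈ (opComp g f).domain ↔ ∃ hx : x ∈ f.domain, f ⟨x, hx⟩ ∈ g.domain := by
  constructor
  · rintro ⟨⟨y, hy, rfl⟩, hx⟩
    exact ⟨y.2, hy⟩
  · rintro ⟨hx, hfx⟩
    exact ⟨⟨⟨x, hx⟩, hfx, rfl⟩, hx⟩

theorem opComp_apply {E F G : Type*} [AddCommGroup E] [Module ℂ E] [AddCommGroup F]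
    [Module ℂ F] [AddCommGroup G] [Module ℂ G] (g : F →ₗ.[ℂ] G) (f : E →ₗ.[ℂ] F)
    (x : (opComp g f).domain) (hx : (x : E) ∈ f.domain) (hfx : f ⟨x, hx⟩ ∈ g.domain) :
    opComp g f x = g ⟨f ⟨x, hx⟩, hfx⟩ := rfl

/-- A positive, symmetric operator, with not necessarily dense domain. -/
structure IsPosSymmetric (a : H →ₗ.[ℂ] H) : Prop where
  symm : ∀ x y : a.domain, inner ℂ (a x) (y : H) = inner ℂ (x : H) (a y)
  nonneg : ∀ x : a.domain, 0 ≤ (inner ℂ (a x) (x : H)).re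

/-- A positive, selfadjoint operator. (Selfadjointness of a partially defined operator entails
that its domain is dense.) -/
structure IsPosSelfAdjoint [CompleteSpace H] (a : H →ₗ.[ℂ] H) : Prop where
  selfAdjoint : IsSelfAdjoint a
  nonneg : ∀ x : a.domain, 0 ≤ (inner ℂ (a x) (x : H)).re

theorem IsPosSelfAdjoint.isPosSymmetric [CompleteSpace H] {a : H →ₗ.[ℂ] H}
    (ha : IsPosSelfAdjoint a) : IsPosSymmetric a where
  symm := by
    have h := LinearPMap.adjoint_isFormalAdjoint ha.selfAdjoint.dense_domain
    rw [LinearPMap.isSelfAdjoint_def.mp ha.selfAdjoint] at h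
    exact h
  nonneg := ha.nonneg

/-- `s` is a positive selfadjoint square root of `a`. -/
structure IsPosSqrt [CompleteSpace H] (s a : H →ₗ.[ℂ] H) : Prop where
  posSelfAdjoint : IsPosSelfAdjoint s
  sq : opComp s s = a

open scoped Classical in
/-- The positive square root `a^{1/2}`: the (unique) positive selfadjoint operator whose square is
`a`; it exists for every positive selfadjoint `a`. -/
def opSqrt [CompleteSpace H] (a : H →ₗ.[ℂ] H) : H →ₗ.[ℂ] H :=
  if h : ∃ s, IsPosSqrt s a then h.choose else 0

/-! ### The classical form sum -/

/-- The operator associated with a sesquilinear form `t` on a dense subspace `D` of `H`: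
`x ∈ D` belongs to its domain and is mapped to `z` iff `t x y = ⟪z, y⟫` for all `y ∈ D`. -/
def formOperator (D : Submodule ℂ H) (t : D →ₗ⋆[ℂ] D →ₗ[ℂ] ℂ) : H →ₗ.[ℂ] H :=
  Submodule.toLinearPMap
    { carrier := {p : H × H | ∃ hx : p.1 ∈ D, ∀ y : D, t ⟨p.1, hx⟩ y = inner ℂ p.2 (y : H)}
      zero_mem' := ⟨D.zero_mem, fun y => by
        rw [show (⟨(0 : H × H).1, D.zero_mem⟩ : D) = 0 from rfl]; simp⟩
      add_mem' := by
        rintro ⟨x, z⟩ ⟨x', z'⟩ ⟨hx, h⟩ ⟨hx', h'⟩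
        refine ⟨D.add_mem hx hx', fun y => ?_⟩
        have e : (⟨((x, z) + (x', z')).1, D.add_mem hx hx'⟩ : D) = ⟨x, hx⟩ + ⟨x', hx'⟩ := rfl
        rw [e, map_add, LinearMap.add_apply, Prod.snd_add, inner_add_left]
        exact congrArg₂ (· + ·) (h y) (h' y)
      smul_mem' := by
        rintro c ⟨x, z⟩ ⟨hx, h⟩
        refine ⟨D.smul_mem c hx, fun y => ?_⟩
        have e : (⟨(c • (x, z)).1, D.smul_mem c hx⟩ : D) = c • ⟨x, hx⟩ := rfl
        rw [e, LinearMap.map_smulₛₗ, LinearMap.smul_apply, Prod.smul_snd, inner_smul_left,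
          smul_eq_mul]
        exact congrArg (conj c * ·) (h y) }

theorem mem_formOperator_graph (D : Submodule ℂ H) (t : D →ₗ⋆[ℂ] D →ₗ[ℂ] ℂ)
    (hD : Dense (D : Set H)) (x z : H) :
    (x, z) ∈ (formOperator D t).graph ↔
      ∃ hx : x ∈ D, ∀ y : D, t ⟨x, hx⟩ y = inner ℂ z (y : H) := by
  rw [formOperator, Submodule.toLinearPMap_graph_eq]
  · rfl
  · rintro ⟨x, z⟩ ⟨hx, h⟩ rfl
    refine hD.eq_zero_of_inner_left ℂ fun y hy => ?_
    rw [← h ⟨y, hy⟩, show (⟨((0 : H), z).1, hx⟩ : D) = 0 from rfl, map_zero,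
      LinearMap.zero_apply]

/-- The closed form of a positive selfadjoint operator given by its square root `s`, restricted to
a subspace `D` of `dom s`: `(x, y) ↦ ⟪s x, s y⟫`. -/
def sqrtForm (s : H →ₗ.[ℂ] H) (D : Submodule ℂ H) (hD : D ≤ s.domain) :
    D →ₗ⋆[ℂ] D →ₗ[ℂ] ℂ :=
  ((innerₛₗ ℂ).comp (s.toFun ∘ₗ Submodule.inclusion hD)).compl₂ (s.toFun ∘ₗ Submodule.inclusion hD)

theorem sqrtForm_apply (s : H →ₗ.[ℂ] H) (D : Submodule ℂ H) (hD : D ≤ s.domain) (x y : D) :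
    sqrtForm s D hD x y = inner ℂ (s ⟨x, hD x.2⟩) (s ⟨y, hD y.2⟩) := rfl

/-- The form sum of `a` and `b`: the operator associated with the form
`⟪a^{1/2} x, a^{1/2} y⟫ + ⟪b^{1/2} x, b^{1/2} y⟫` on `dom a^{1/2} ∩ dom b^{1/2}`. -/
def formSum [CompleteSpace H] (a b : H →ₗ.[ℂ] H) : H →ₗ.[ℂ] H :=
  formOperator ((opSqrt a).domain ⊓ (opSqrt b).domain)
    (sqrtForm (opSqrt a) _ inf_le_left + sqrtForm (opSqrt b) _ inf_le_right)

/-! ### The auxiliary Hilbert space of a positive symmetric operator -/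

/-- The form domain
`D_*(a) = {y | ∃ m, ∀ x ∈ dom a, |(a x, y)|² ≤ m (a x, x)}`. -/
def formDomain (a : H →ₗ.[ℂ] H) : Set H :=
  {y | ∃ m : ℝ, ∀ x : a.domain, ‖inner ℂ (a x) y‖ ^ 2 ≤ m * (inner ℂ (a x) (x : H)).re}

/-- The operators to which the construction applies: positive symmetric operators with dense form
domain. -/
structure IsAdmissible (a : H →ₗ.[ℂ] H) : Prop where
  posSymmetric : IsPosSymmetric a
  dense : Dense (formDomain a)

/-- The vector space `ran a`, to be equipped with the inner product `⟨a x, a y⟩ = (a x, y)`. -/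
def Ran (a : H →ₗ.[ℂ] H) (_ha : IsAdmissible a) : Type _ := LinearMap.range a.toFun

namespace Ran

variable {a : H →ₗ.[ℂ] H} (ha : IsAdmissible a)

instance : AddCommGroup (Ran a ha) := inferInstanceAs (AddCommGroup (LinearMap.range a.toFun))

instance : Module ℂ (Ran a ha) := inferInstanceAs (Module ℂ (LinearMap.range a.toFun))

/-- The inclusion of `ran a` into `H`. -/
def incl : Ran a ha →ₗ[ℂ] H := (LinearMap.range a.toFun).subtype

theorem incl_injective : Function.Injective (incl ha) := Subtype.val_injective

/-- The element `a x` of `ran a`. -/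
def of : a.domain →ₗ[ℂ] Ran a ha := a.toFun.rangeRestrict

theorem incl_of (x : a.domain) : incl ha (of ha x) = a x := rfl

/-- Some preimage of an element of `ran a`. -/
def preim (p : Ran a ha) : a.domain := p.2.choose

theorem map_preim (p : Ran a ha) : a (preim ha p) = incl ha p := p.2.choose_spec

/-- The inner product `⟨a x, a y⟩ = (a x, y)` on `ran a` (see `inner_of`). -/
abbrev core : InnerProductSpace.Core ℂ (Ran a ha) where
  inner p q := inner ℂ (incl ha p) (preim ha q : H)
  conj_inner_symm p q := by
    rw [inner_conj_symm, ← map_preim, ← map_preim, ha.posSymmetric.symm]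
  re_inner_nonneg p := by
    rw [← map_preim]
    exact ha.posSymmetric.nonneg _
  add_left p q r := by rw [map_add, inner_add_left]
  smul_left p q c := by rw [map_smul, inner_smul_left]
  definite p hp := by
    rw [← map_preim] at hp
    apply incl_injective ha
    rw [map_zero]
    refine ha.dense.eq_zero_of_inner_left ℂ fun y hy => ?_
    obtain ⟨m, hm⟩ := hy
    have h := hm (preim ha p)
    rw [hp, Complex.zero_re, mul_zero, map_preim] at h
    exact norm_eq_zero.mp (pow_eq_zero_iff two_ne_zero |>.mp (le_antisymm h (sq_nonneg _)))

instance : NormedAddCommGroup (Ran a ha) := (core ha).toNormedAddCommGroup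

instance : InnerProductSpace ℂ (Ran a ha) := InnerProductSpace.ofCore (core ha).toCore

theorem inner_of (x y : a.domain) :
    inner ℂ (of ha x) (of ha y) = inner ℂ (a x) (y : H) := by
  change inner ℂ (a x) (preim ha (of ha y) : H) = _
  rw [ha.posSymmetric.symm, map_preim, incl_of, ha.posSymmetric.symm]

end Ran

/-- The Hilbert space `H_a`, the completion of `ran a`. -/
abbrev HilbertRan (a : H →ₗ.[ℂ] H) (ha : IsAdmissible a) : Type _ :=
  UniformSpace.Completion (Ran a ha)

variable {a b : H →ₗ.[ℂ] H}

/-- The embedding of `ran a ⊕ ran b` into the Hilbert space direct sum `H_a ⊕ H_b`. -/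
def sumEmb (ha : IsAdmissible a) (hb : IsAdmissible b) :
    Ran a ha × Ran b hb →ₗ[ℂ] WithLp 2 (HilbertRan a ha × HilbertRan b hb) :=
  (WithLp.linearEquiv 2 ℂ (HilbertRan a ha × HilbertRan b hb)).symm.toLinearMap ∘ₗ
    LinearMap.prodMap
      (UniformSpace.Completion.toComplₗᵢ (𝕜 := ℂ) (E := Ran a ha)).toLinearMap
      (UniformSpace.Completion.toComplₗᵢ (𝕜 := ℂ) (E := Ran b hb)).toLinearMap

theorem sumEmb_apply (ha : IsAdmissible a) (hb : IsAdmissible b) (p : Ran a ha) (q : Ran b hb) :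
    sumEmb ha hb (p, q) =
      WithLp.toLp 2 ((p : HilbertRan a ha), (q : HilbertRan b hb)) := rfl

theorem sumEmb_injective (ha : IsAdmissible a) (hb : IsAdmissible b) :
    Function.Injective (sumEmb ha hb) :=
  (WithLp.linearEquiv 2 ℂ (HilbertRan a ha × HilbertRan b hb)).symm.injective.comp
    ((UniformSpace.Completion.toComplₗᵢ (𝕜 := ℂ) (E := Ran a ha)).injective.prodMap
      (UniformSpace.Completion.toComplₗᵢ (𝕜 := ℂ) (E := Ran b hb)).injective)

/-- The operator `J : H_a ⊕ H_b → H` with domain `ran a ⊕ ran b` and `J (a x ⊕ b y) = a x + b y`. -/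
def opJ (ha : IsAdmissible a) (hb : IsAdmissible b) :
    WithLp 2 (HilbertRan a ha × HilbertRan b hb) →ₗ.[ℂ] H where
  domain := LinearMap.range (sumEmb ha hb)
  toFun := (LinearMap.coprod (Ran.incl ha) (Ran.incl hb)) ∘ₗ
    (LinearEquiv.ofInjective (sumEmb ha hb) (sumEmb_injective ha hb)).symm.toLinearMap

theorem opJ_apply (ha : IsAdmissible a) (hb : IsAdmissible b) (x : a.domain) (y : b.domain) :
    opJ ha hb ⟨sumEmb ha hb (Ran.of ha x, Ran.of hb y), LinearMap.mem_range_self _ _⟩ =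
      a x + b y := by
  change (LinearMap.coprod (Ran.incl ha) (Ran.incl hb))
    ((LinearEquiv.ofInjective (sumEmb ha hb) (sumEmb_injective ha hb)).symm
      ((LinearEquiv.ofInjective (sumEmb ha hb) (sumEmb_injective ha hb))
        (Ran.of ha x, Ran.of hb y))) = _
  rw [LinearEquiv.symm_apply_apply, LinearMap.coprod_apply, Ran.incl_of, Ran.incl_of]

/-- The operator `J** J*`. -/
def opJJ [CompleteSpace H] (ha : IsAdmissible a) (hb : IsAdmissible b) : H →ₗ.[ℂ] H :=
  opComp (opJ ha hb)†† (opJ ha hb)†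

/-! ### Positive selfadjoint operators are admissible -/

theorem IsPosSymmetric.domain_subset_formDomain (ha : IsPosSymmetric a) :
    (a.domain : Set H) ⊆ formDomain a := by
  intro y hy
  let c : PreInnerProductSpace.Core ℂ a.domain :=
    { inner := fun u v => inner ℂ (a u) (v : H)
      conj_inner_symm := fun u v => by rw [inner_conj_symm, ha.symm]
      re_inner_nonneg := fun u => ha.nonneg u
      add_left := fun u v w => by rw [LinearPMap.map_add, inner_add_left]
      smul_left := fun u v r => by rw [LinearPMap.map_smul, inner_smul_left] }
  refine ⟨(inner ℂ (a ⟨y, hy⟩) y).re, fun x => ?_⟩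
  have h := InnerProductSpace.Core.inner_mul_inner_self_le (𝕜 := ℂ) (c := c) x ⟨y, hy⟩
  have h' : ‖inner ℂ (a x) y‖ * ‖inner ℂ (a ⟨y, hy⟩) (x : H)‖ ≤
      (inner ℂ (a x) (x : H)).re * (inner ℂ (a ⟨y, hy⟩) y).re := h
  rw [ha.symm ⟨y, hy⟩ x, norm_inner_symm y (a x)] at h'
  rw [sq, mul_comm (inner ℂ (a ⟨y, hy⟩) y).re]
  exact h'

theorem IsPosSelfAdjoint.isAdmissible [CompleteSpace H] (ha : IsPosSelfAdjoint a) :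
    IsAdmissible a where
  posSymmetric := ha.isPosSymmetric
  dense := ha.selfAdjoint.dense_domain.mono ha.isPosSymmetric.domain_subset_formDomain

end

end FormSum

namespace FormSum

noncomputable section

open scoped ComplexConjugate LinearPMap

variable {H : Type*} [NormedAddCommGroup H] [InnerProductSpace ℂ H]

/-! ### Closed operators and orthogonal projection onto the graph -/

section Closed

variable {K : Type*} [NormedAddCommGroup K] [InnerProductSpace ℂ K]

/-! Write `s = a^{1/2}`, `t = b^{1/2}`. Since `⟨ax, ay⟩_a = (ax, y) = (sx, sy)`, the map `ax ↦ sx`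
extends to an isometry `V : H_a → H` (`IsPosSqrt.exists_isometry`). The adjoint of `J` acts
componentwise: `J* x = u ⊕ v`, where `u` and `v` represent `(x, ·)` on `ran a` and on `ran b`. Such
a `u` exists exactly when `x ∈ dom s`, and then `V u - s x` is orthogonal to `ran s`, which contains
`V (ran a)`; hence `u` has the same inner products as `s x`. So `dom J* = dom s ∩ dom t` and `⟨J* x,
J* y⟩ = (sx, sy) + (tx, ty)`.

By hypothesis `J*` is densely defined, so `J** J* x = z` means `⟨J* x, J* y⟩ = (z, y)` for all `y ∈
dom J*`, which is the definition of the form sum. Selfadjointness is von Neumann's theorem on `T* T`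
with `T = J*`.

The square root itself is built from the bounded resolvent `R = (1 + a)⁻¹`: its graph is `{(R^{1/2}
x, (1 - R)^{1/2} x)}`. -/

/-- Every pair of vectors has an orthogonal projection onto the graph of a closed operator. -/
theorem exists_graph_projection [CompleteSpace H] [CompleteSpace K] {T : H →ₗ.[ℂ] K}
    (hT : T.IsClosed) (u : H) (v : K) :
    ∃ p : T.domain, ∀ y : T.domain,
      inner ℂ (u - p) (y : H) + inner ℂ (v - T p) (T y) = 0 := by
  let G : Submodule ℂ (WithLp 2 (H × K)) :=
    T.graph.comap (WithLp.linearEquiv 2 ℂ (H × K)).toLinearMap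
  have hG : IsClosed (G : Set (WithLp 2 (H × K))) :=
    IsClosed.preimage (WithLp.prod_continuous_ofLp 2 H K) hT
  have : CompleteSpace G := hG.completeSpace_coe
  have hmem := (G.starProjection_apply_mem (WithLp.toLp 2 (u, v)))
  obtain ⟨p, hp₁, hp₂⟩ := (LinearPMap.mem_graph_iff (f := T)).mp (show _ ∈ T.graph from hmem)
  refine ⟨p, fun y => ?_⟩
  have hy : WithLp.toLp 2 ((y : H), T y) ∈ G := T.mem_graph y
  have h := G.starProjection_inner_eq_zero (WithLp.toLp 2 (u, v)) _ hy
  rw [WithLp.prod_inner_apply] at h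
  rw [hp₁, hp₂]
  exact h

theorem mem_adjoint_graph_iff [CompleteSpace H] {T : H →ₗ.[ℂ] K}
    (hT : Dense (T.domain : Set H)) (y : K) (z : H) :
    (y, z) ∈ T†.graph ↔ ∀ x : T.domain, inner ℂ z (x : H) = inner ℂ y (T x) := by
  rw [LinearPMap.mem_graph_iff]
  constructor
  · rintro ⟨y, rfl, rfl⟩ x
    exact LinearPMap.adjoint_isFormalAdjoint hT y x
  · intro h
    exact ⟨⟨y, LinearPMap.mem_adjoint_domain_of_exists y ⟨z, h⟩⟩, rfl,
      LinearPMap.adjoint_apply_eq hT _ h⟩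

/-- A positive symmetric operator `c` with `ran (1 + c) = H` is selfadjoint. -/
theorem IsPosSymmetric.isPosSelfAdjoint [CompleteSpace H] {c : H →ₗ.[ℂ] H}
    (hc : IsPosSymmetric c) (hsurj : ∀ z : H, ∃ x : c.domain, (x : H) + c x = z) :
    IsPosSelfAdjoint c := by
  -- If `y = x + c x` is orthogonal to `dom c`, pairing with `x` gives `‖x‖² + (c x, x) = 0`, so `x
  -- = 0`.
  have hdense : Dense (c.domain : Set H) := by
    rw [Submodule.dense_iff_topologicalClosure_eq_top,
      Submodule.topologicalClosure_eq_top_iff, Submodule.eq_bot_iff]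
    intro y hy
    obtain ⟨x, rfl⟩ := hsurj y
    have h := (Submodule.mem_orthogonal' _ _).mp hy x x.2
    rw [inner_add_left] at h
    have h1 := congrArg Complex.re h
    have h2 := hc.nonneg x
    have h3 : 0 ≤ (inner ℂ (x : H) (x : H)).re := inner_self_nonneg (𝕜 := ℂ)
    rw [Complex.add_re, Complex.zero_re] at h1
    have h4 : (inner ℂ (x : H) (x : H)).re = 0 := by linarith
    have h5 : (x : H) = 0 := by
      rw [← re_inner_self_nonpos (𝕜 := ℂ)]; exact h4.le
    have h6 : x = 0 := Subtype.ext h5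
    rw [h6]; simp
  refine ⟨?_, hc.nonneg⟩
  rw [LinearPMap.isSelfAdjoint_def]
  refine LinearPMap.eq_of_eq_graph (Submodule.ext ?_)
  rintro ⟨y, z⟩
  rw [mem_adjoint_graph_iff hdense, LinearPMap.mem_graph_iff]
  constructor
  · intro h
    obtain ⟨x, hx⟩ := hsurj (y + z)
    -- Surjectivity of `1 + c` again: `x - y` is orthogonal to every `w + c w`, in particular to
    -- itself.
    have hxy : (x : H) = y := by
      rw [← sub_eq_zero]
      obtain ⟨w, hw⟩ := hsurj ((x : H) - y)
      rw [← inner_self_eq_zero (𝕜 := ℂ)]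
      nth_rewrite 2 [← hw]
      have h1 := h w
      have h2 := hc.symm x w
      have h3 : inner ℂ ((x : H) + c x) (w : H) = inner ℂ (y + z) (w : H) := by rw [hx]
      rw [inner_add_left, inner_add_left] at h3
      rw [inner_add_right, inner_sub_left, inner_sub_left]
      linear_combination h3 + h1 - h2
    exact ⟨x, hxy, by simpa [hxy] using hx⟩
  · rintro ⟨x, rfl, rfl⟩ w
    exact hc.symm x w

theorem mem_opComp_graph {E F G : Type*} [AddCommGroup E] [Module ℂ E] [AddCommGroup F]
    [Module ℂ F] [AddCommGroup G] [Module ℂ G] (g : F →ₗ.[ℂ] G) (f : E →ₗ.[ℂ] F) (x : E) (z : G) :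
    (x, z) ∈ (opComp g f).graph ↔ ∃ y, (x, y) ∈ f.graph ∧ (y, z) ∈ g.graph := by
  constructor
  · intro h
    obtain ⟨x', rfl, rfl⟩ := (LinearPMap.mem_graph_iff _).mp h
    obtain ⟨hx, hfx⟩ := (mem_opComp_domain g f x').mp x'.2
    exact ⟨f ⟨x', hx⟩, f.mem_graph ⟨x', hx⟩, by
      rw [opComp_apply g f x' hx hfx]; exact g.mem_graph ⟨_, hfx⟩⟩
  · rintro ⟨y, h, h'⟩
    obtain ⟨x', rfl, rfl⟩ := (LinearPMap.mem_graph_iff _).mp h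
    obtain ⟨y', hy', rfl⟩ := (LinearPMap.mem_graph_iff _).mp h'
    have hfx : f ⟨x', x'.2⟩ ∈ g.domain := by
      change f x' ∈ g.domain
      rw [← show (y' : F) = f x' from hy']; exact y'.2
    have hx := (mem_opComp_domain g f x').mpr ⟨x'.2, hfx⟩
    refine (LinearPMap.mem_graph_iff _).mpr ⟨⟨x', hx⟩, rfl, ?_⟩
    rw [opComp_apply g f ⟨x', hx⟩ x'.2 hfx]
    exact congrArg g (Subtype.ext hy'.symm)

/-- Von Neumann's theorem: `T* T` is positive and selfadjoint for closed, densely defined `T`. -/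
theorem isPosSelfAdjoint_adjoint_comp_self [CompleteSpace H] [CompleteSpace K] {T : H →ₗ.[ℂ] K}
    (hT : T.IsClosed) (hd : Dense (T.domain : Set H)) : IsPosSelfAdjoint (opComp T† T) := by
  have key : ∀ x : (opComp T† T).domain, ∃ hx : (x : H) ∈ T.domain,
      ∀ y : T.domain, inner ℂ (opComp T† T x) (y : H) = inner ℂ (T ⟨x, hx⟩) (T y) := by
    intro x
    obtain ⟨hx, hTx⟩ := (mem_opComp_domain _ _ _).mp x.2
    exact ⟨hx, fun y => LinearPMap.adjoint_isFormalAdjoint hd ⟨_, hTx⟩ y⟩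
  refine IsPosSymmetric.isPosSelfAdjoint ⟨fun x y => ?_, fun x => ?_⟩ fun z => ?_
  · obtain ⟨hx, h⟩ := key x
    obtain ⟨hy, h'⟩ := key y
    rw [← inner_conj_symm (x : H), h' ⟨x, hx⟩, h ⟨y, hy⟩, inner_conj_symm]
  · obtain ⟨hx, h⟩ := key x
    rw [h ⟨x, hx⟩]
    exact inner_self_nonneg (𝕜 := ℂ)
  -- Projecting `(z, 0)` onto the graph of `T` gives `(z - p, y) = (T p, T y)` for all `y`, that is,
  -- `T* T p = z - p`.
  · obtain ⟨p, hp⟩ := exists_graph_projection hT z 0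
    have hg : ((p : H), z - p) ∈ (opComp T† T).graph := by
      refine (mem_opComp_graph _ _ _ _).mpr ⟨T p, T.mem_graph p, ?_⟩
      rw [mem_adjoint_graph_iff hd]
      intro y
      have := hp y
      rw [zero_sub, inner_neg_left] at this
      linear_combination this
    obtain ⟨x, hx, hx'⟩ := (LinearPMap.mem_graph_iff _).mp hg
    refine ⟨x, ?_⟩
    simp only at hx hx'
    rw [hx', hx]; simp

end Closed

/-! ### The resolvent and the square root of a positive selfadjoint operator -/

section Sqrt

variable {a : H →ₗ.[ℂ] H}

theorem IsPosSymmetric.norm_sq_add_le (ha : IsPosSymmetric a) (x : a.domain) :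
    ‖(x : H)‖ ^ 2 + ‖a x‖ ^ 2 ≤ ‖(x : H) + a x‖ ^ 2 := by
  have h := norm_add_sq (𝕜 := ℂ) (x : H) (a x)
  have h' : 0 ≤ (inner ℂ (x : H) (a x)).re := by rw [← ha.symm]; exact ha.nonneg x
  have h'' : RCLike.re (inner ℂ (x : H) (a x)) = (inner ℂ (x : H) (a x)).re := rfl
  rw [h, h'']; linarith

theorem IsPosSymmetric.norm_le_norm_add (ha : IsPosSymmetric a) (x : a.domain) :
    ‖(x : H)‖ ≤ ‖(x : H) + a x‖ :=
  (sq_le_sq₀ (norm_nonneg _) (norm_nonneg _)).mp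
    (by linarith [ha.norm_sq_add_le x, sq_nonneg ‖a x‖])

theorem IsPosSymmetric.norm_apply_le_norm_add (ha : IsPosSymmetric a) (x : a.domain) :
    ‖a x‖ ≤ ‖(x : H) + a x‖ :=
  (sq_le_sq₀ (norm_nonneg _) (norm_nonneg _)).mp
    (by linarith [ha.norm_sq_add_le x, sq_nonneg ‖(x : H)‖])

theorem mem_graph_iff_of_resolvent (ha : IsPosSymmetric a) {R : H →L[ℂ] H}
    (hR : ∀ z, (R z, z - R z) ∈ a.graph) (x z : H) :
    (x, z) ∈ a.graph ↔ x = R (x + z) := by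
  constructor
  · intro h
    have h' := a.graph.sub_mem h (hR (x + z))
    obtain ⟨y, hy, hy'⟩ := (LinearPMap.mem_graph_iff _).mp h'
    have h1 := ha.norm_le_norm_add y
    rw [hy, hy'] at h1
    simp only [Prod.mk_sub_mk] at h1
    rw [show x - R (x + z) + (z - (x + z - R (x + z))) = 0 by abel, norm_zero] at h1
    exact sub_eq_zero.mp (norm_le_zero_iff.mp h1)
  · intro h
    have h' := hR (x + z)
    rw [← h] at h'
    simpa using h'

variable [CompleteSpace H]

/-- The range of `1 + a` is closed, because `1 + a` is bounded below on the closed graph of `a`. It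
is dense, because a vector `y` orthogonal to it satisfies `a y = -y`, which positivity allows only
for `y = 0`. -/
theorem IsPosSelfAdjoint.exists_add_eq (ha : IsPosSelfAdjoint a) (z : H) :
    ∃ x : a.domain, (x : H) + a x = z := by
  let f : a.graph →L[ℂ] H :=
    (ContinuousLinearMap.fst ℂ H H + ContinuousLinearMap.snd ℂ H H).comp a.graph.subtypeL
  have hf : ∀ x : a.domain, f ⟨(x, a x), a.mem_graph x⟩ = x + a x := fun x => rfl
  have : CompleteSpace a.graph := ha.selfAdjoint.isClosed.completeSpace_coe
  have hanti : AntilipschitzWith 1 f := by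
    refine AddMonoidHomClass.antilipschitz_of_bound f ?_
    rintro ⟨⟨x, y⟩, hxy⟩
    obtain ⟨x, rfl, rfl⟩ := (LinearPMap.mem_graph_iff _).mp hxy
    rw [hf, NNReal.coe_one, one_mul]
    exact max_le (ha.isPosSymmetric.norm_le_norm_add x) (ha.isPosSymmetric.norm_apply_le_norm_add x)
  have hcl : IsClosed (LinearMap.range f.toLinearMap : Set H) := by
    rw [LinearMap.coe_range]
    exact hanti.isClosed_range f.uniformContinuous
  have htop : LinearMap.range f.toLinearMap = ⊤ := by
    rw [← hcl.submodule_topologicalClosure_eq, Submodule.topologicalClosure_eq_top_iff,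
      Submodule.eq_bot_iff]
    intro y hy
    have hg : (y, -y) ∈ a.graph := by
      rw [← LinearPMap.isSelfAdjoint_def.mp ha.selfAdjoint,
        mem_adjoint_graph_iff ha.selfAdjoint.dense_domain]
      intro x
      have h := (Submodule.mem_orthogonal' _ _).mp hy _ ⟨⟨(x, a x), a.mem_graph x⟩, rfl⟩
      have h' : inner ℂ y ((x : H) + a x) = 0 := h
      rw [inner_add_right] at h'
      rw [inner_neg_left]
      linear_combination -h'
    obtain ⟨x, rfl, hx⟩ := (LinearPMap.mem_graph_iff _).mp hg
    have h := ha.nonneg x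
    simp only at hx
    rw [hx, inner_neg_left, Complex.neg_re] at h
    rw [← re_inner_self_nonpos (𝕜 := ℂ)]
    exact neg_nonneg.mp h
  obtain ⟨⟨⟨x, y⟩, hxy⟩, h⟩ := htop.ge (Submodule.mem_top (x := z))
  obtain ⟨x, rfl, rfl⟩ := (LinearPMap.mem_graph_iff _).mp hxy
  exact ⟨x, h⟩

/-- The resolvent `(1 + a)⁻¹`, as a bounded operator. -/
theorem IsPosSelfAdjoint.exists_resolvent (ha : IsPosSelfAdjoint a) :
    ∃ R : H →L[ℂ] H, ∀ z, (R z, z - R z) ∈ a.graph := by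
  let f : a.domain →ₗ[ℂ] H := a.domain.subtype + a.toFun
  have hf : ∀ x : a.domain, f x = x + a x := fun x => rfl
  have hle : ∀ x : a.domain, ‖(x : H)‖ ≤ ‖f x‖ := ha.isPosSymmetric.norm_le_norm_add
  have hinj : Function.Injective f := by
    rw [injective_iff_map_eq_zero]
    intro x hx
    have := hle x
    rw [hx, norm_zero] at this
    exact Subtype.ext (norm_le_zero_iff.mp this)
  let e := LinearEquiv.ofBijective f ⟨hinj, ha.exists_add_eq⟩
  refine ⟨(a.domain.subtype ∘ₗ e.symm.toLinearMap).mkContinuous 1 fun z => ?_, fun z => ?_⟩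
  · obtain ⟨x, rfl⟩ := e.surjective z
    rw [one_mul]
    simpa using show ‖(x : H)‖ ≤ ‖e x‖ from hle x
  · obtain ⟨x, rfl⟩ := e.surjective z
    have h : ((x : H), e x - x) ∈ a.graph := by
      have : e x - x = a x := by
        change (x : H) + a x - x = a x
        abel
      rw [this]; exact a.mem_graph x
    simpa using h

/-- If `S` and `T` are commuting bounded selfadjoint operators with `S T` positive and
`S² + T² = 1`, and `a` is the operator `S² x ↦ T² x`, then `S x ↦ T x` is a square root of `a`. -/
theorem exists_isPosSqrt_of_commute {S T : H →L[ℂ] H}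
    (hS : ∀ x y, inner ℂ (S x) y = inner ℂ x (S y)) (hT : ∀ x y, inner ℂ (T x) y = inner ℂ x (T y))
    (hcomm : ∀ x, S (T x) = T (S x)) (hpos : ∀ x, 0 ≤ (inner ℂ (S (T x)) x).re)
    (hone : ∀ x, S (S x) + T (T x) = x)
    (ha : ∀ x z, (x, z) ∈ a.graph ↔ x = S (S (x + z))) : ∃ s, IsPosSqrt s a := by
  -- If `S x = 0`, then `(0, x)` lies in the graph of `a`.
  have hinj : ∀ x, S x = 0 → x = 0 := fun x hx =>
    LinearPMap.graph_fst_eq_zero_snd a ((ha 0 x).mpr (by rw [zero_add, hx, map_zero])) rfl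
  let g : Submodule ℂ (H × H) := LinearMap.range (S.prod T).toLinearMap
  let s : H →ₗ.[ℂ] H := g.toLinearPMap
  have hs : ∀ p q, (p, q) ∈ s.graph ↔ ∃ x, S x = p ∧ T x = q := by
    intro p q
    rw [Submodule.toLinearPMap_graph_eq]
    · exact exists_congr fun x => Prod.ext_iff
    · rintro _ ⟨x, rfl⟩ hx
      rw [hinj x hx]
      exact map_zero T
  have hrep : ∀ p : s.domain, ∃ x, S x = p ∧ T x = s p := fun p => (hs _ _).mp (s.mem_graph p)
  have hdense : Dense (s.domain : Set H) := by
    rw [Submodule.dense_iff_topologicalClosure_eq_top,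
      Submodule.topologicalClosure_eq_top_iff, Submodule.eq_bot_iff]
    intro y hy
    refine hinj y ?_
    rw [← inner_self_eq_zero (𝕜 := ℂ), hS]
    exact (Submodule.mem_orthogonal' _ _).mp hy _
      (LinearPMap.mem_domain_of_mem_graph ((hs _ _).mpr ⟨S y, rfl, rfl⟩))
  refine ⟨s, ⟨⟨?_, fun p => ?_⟩, ?_⟩⟩
  · rw [LinearPMap.isSelfAdjoint_def]
    refine LinearPMap.eq_of_eq_graph (Submodule.ext ?_)
    rintro ⟨y, z⟩
    rw [mem_adjoint_graph_iff hdense, hs]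
    constructor
    · intro h
      have hyz : S z = T y := by
        refine ext_inner_right ℂ fun x => ?_
        obtain ⟨p, hp, hp'⟩ := (LinearPMap.mem_graph_iff _).mp ((hs _ _).mpr ⟨x, rfl, rfl⟩)
        have h' := h p
        rw [hp, hp'] at h'
        rw [hS, hT]
        exact h'
      -- The preimage of `(y, z)` is forced: if `y = S x` and `z = T x`, then `S y + T z = (S² + T²)
      -- x = x`.
      refine ⟨S y + T z, ?_, ?_⟩
      · rw [map_add, hcomm, hyz, hone]
      · rw [map_add, ← hcomm, ← hyz, hone]
    · rintro ⟨x, rfl, rfl⟩ p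
      obtain ⟨w, hw, hw'⟩ := hrep p
      rw [← hw, ← hw', hT, hS, hcomm]
  · obtain ⟨w, hw, hw'⟩ := hrep p
    rw [← hw, ← hw', ← hS]
    exact hpos w
  · refine LinearPMap.eq_of_eq_graph (Submodule.ext ?_)
    rintro ⟨x, z⟩
    rw [mem_opComp_graph, ha]
    constructor
    · rintro ⟨y, hxy, hyz⟩
      obtain ⟨u, rfl, rfl⟩ := (hs _ _).mp hxy
      obtain ⟨v, hv, rfl⟩ := (hs _ _).mp hyz
      rw [map_add S (S u), hcomm v, hv, hone]
    · intro h
      refine ⟨T (S (x + z)), (hs _ _).mpr ⟨S (x + z), h.symm, rfl⟩,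
        (hs _ _).mpr ⟨T (x + z), hcomm _, ?_⟩⟩
      have hsum := hone (x + z)
      rw [← h] at hsum
      exact add_left_cancel hsum

/-- Every positive selfadjoint operator has a positive selfadjoint square root, namely
`(1 - R)^{1/2} R^{-1/2}` where `R = (1 + a)⁻¹`. -/
theorem IsPosSelfAdjoint.exists_isPosSqrt (ha : IsPosSelfAdjoint a) : ∃ s, IsPosSqrt s a := by
  obtain ⟨R, hR⟩ := ha.exists_resolvent
  have hgraph := mem_graph_iff_of_resolvent ha.isPosSymmetric hR
  have hsymm : ∀ z w, inner ℂ (R z) w = inner ℂ z (R w) := by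
    intro z w
    obtain ⟨x, hx, hx'⟩ := (LinearPMap.mem_graph_iff _).mp (hR z)
    obtain ⟨y, hy, hy'⟩ := (LinearPMap.mem_graph_iff _).mp (hR w)
    have h := ha.isPosSymmetric.symm x y
    rw [hx, hx', hy, hy', inner_sub_left, inner_sub_right] at h
    linear_combination -h
  have hre : ∀ z, 0 ≤ (inner ℂ (z - R z) (R z)).re := by
    intro z
    obtain ⟨x, hx, hx'⟩ := (LinearPMap.mem_graph_iff _).mp (hR z)
    have h := ha.nonneg x
    rwa [hx, hx'] at h
  have hR0 : 0 ≤ R := by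
    rw [ContinuousLinearMap.nonneg_iff_isPositive, ContinuousLinearMap.isPositive_def]
    refine ⟨hsymm, fun z => ?_⟩
    have h := hre z
    have h' : 0 ≤ (inner ℂ (R z) (R z)).re := inner_self_nonneg (𝕜 := ℂ)
    rw [inner_sub_left, Complex.sub_re] at h
    change 0 ≤ (inner ℂ (R z) z).re
    rw [hsymm]
    linarith
  have hR1 : 0 ≤ 1 - R := by
    rw [ContinuousLinearMap.nonneg_iff_isPositive, ContinuousLinearMap.isPositive_def]
    refine ⟨fun z w => ?_, fun z => ?_⟩
    · change inner ℂ (z - R z) w = inner ℂ z (w - R w)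
      rw [inner_sub_left, inner_sub_right, hsymm]
    · have h := hre z
      have h' : 0 ≤ (inner ℂ (z - R z) (z - R z)).re := inner_self_nonneg (𝕜 := ℂ)
      rw [inner_sub_right, Complex.sub_re] at h'
      change 0 ≤ (inner ℂ (z - R z) z).re
      linarith
  -- The functional calculus preserves commutation; it is applied to each factor in turn.
  have hcomm : Commute (CFC.sqrt R) (CFC.sqrt (1 - R)) := by
    have h : Commute R (1 - R) := (Commute.one_right R).sub_right (Commute.refl R)
    unfold CFC.sqrt
    exact ((h.cfcₙ_nnreal _).symm.cfcₙ_nnreal _).symm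
  have hpos := hcomm.mul_nonneg (CFC.sqrt_nonneg R) (CFC.sqrt_nonneg (1 - R))
  have hS := CFC.sqrt_nonneg R
  have hT := CFC.sqrt_nonneg (1 - R)
  rw [ContinuousLinearMap.nonneg_iff_isPositive] at hpos hS hT
  have hSS : ∀ x, CFC.sqrt R (CFC.sqrt R x) = R x := fun x =>
    congrArg (fun A : H →L[ℂ] H => A x) (CFC.sqrt_mul_sqrt_self R hR0)
  have hTT : ∀ x, CFC.sqrt (1 - R) (CFC.sqrt (1 - R) x) = x - R x := fun x =>
    congrArg (fun A : H →L[ℂ] H => A x) (CFC.sqrt_mul_sqrt_self (1 - R) hR1)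
  refine exists_isPosSqrt_of_commute hS.inner_left_eq_inner_right hT.inner_left_eq_inner_right
    (fun x => congrArg (fun A : H →L[ℂ] H => A x) hcomm.eq) hpos.re_inner_nonneg_left
    (fun x => ?_) fun x z => ?_
  · rw [hSS, hTT, add_sub_cancel]
  · rw [hSS, hgraph]

end Sqrt

/-! ### The form of a positive operator and its square root -/

section Form

variable [CompleteSpace H] {s a : H →ₗ.[ℂ] H}

theorem IsPosSelfAdjoint.isPosSqrt_opSqrt (ha : IsPosSelfAdjoint a) : IsPosSqrt (opSqrt a) a := by
  have h := ha.exists_isPosSqrt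
  rw [opSqrt, dif_pos h]
  exact h.choose_spec

theorem IsPosSqrt.mem_graph_iff (hs : IsPosSqrt s a) (x z : H) :
    (x, z) ∈ a.graph ↔ ∃ y, (x, y) ∈ s.graph ∧ (y, z) ∈ s.graph := by
  rw [← mem_opComp_graph, hs.sq]

theorem IsPosSqrt.domain_le (hs : IsPosSqrt s a) : a.domain ≤ s.domain := by
  intro x hx
  rw [← hs.sq] at hx
  exact ((mem_opComp_domain _ _ _).mp hx).1

theorem IsPosSqrt.inner_apply (hs : IsPosSqrt s a) (x : a.domain) (y : s.domain) :
    inner ℂ (a x) (y : H) = inner ℂ (s ⟨x, hs.domain_le x.2⟩) (s y) := by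
  obtain ⟨w, hw, hw'⟩ := (hs.mem_graph_iff _ _).mp (a.mem_graph x)
  obtain ⟨x', hx', rfl⟩ := (LinearPMap.mem_graph_iff _).mp hw
  obtain ⟨y', hy', hy⟩ := (LinearPMap.mem_graph_iff _).mp hw'
  have hx : x' = ⟨x, hs.domain_le x.2⟩ := Subtype.ext hx'
  simp only at hy hy'
  rw [← hy, hs.posSelfAdjoint.isPosSymmetric.symm, hy', hx]

/-- If `x` and `v` satisfy the relation `(v, s y) = (x, s (s y))` for all `y ∈ dom a`, then
`x ∈ dom s`, and `v - s x` is orthogonal to `ran s`. -/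
theorem IsPosSqrt.mem_domain_of_forall_inner (hs : IsPosSqrt s a) {x v : H}
    (h : ∀ y : a.domain, inner ℂ v (s ⟨y, hs.domain_le y.2⟩) = inner ℂ x (a y)) :
    ∃ hx : x ∈ s.domain, ∀ y : s.domain, inner ℂ (v - s ⟨x, hx⟩) (s y) = 0 := by
  have hsa := hs.posSelfAdjoint.selfAdjoint
  obtain ⟨p, hp⟩ := exists_graph_projection hsa.isClosed x v
  have hself : IsPosSelfAdjoint a := by
    have := isPosSelfAdjoint_adjoint_comp_self hsa.isClosed hsa.dense_domain
    rwa [LinearPMap.isSelfAdjoint_def.mp hsa, hs.sq] at this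
  -- Testing the projection of `(x, v)` against `(y, s y)` with `y ∈ dom a` shows `x - p ⊥ y + a y`,
  -- and `1 + a` is onto.
  have hxp : x - p = 0 := by
    obtain ⟨y, hy⟩ := hself.exists_add_eq (x - p)
    rw [← inner_self_eq_zero (𝕜 := ℂ)]
    nth_rewrite 2 [← hy]
    have h1 := hp ⟨y, hs.domain_le y.2⟩
    have h2 := h y
    have h3 := hs.inner_apply y p
    rw [← inner_conj_symm, ← inner_conj_symm (s _)] at h3
    have h4 := (starRingEnd ℂ).injective h3
    rw [inner_sub_left (𝕜 := ℂ) v] at h1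
    rw [inner_add_right, inner_sub_left (𝕜 := ℂ) x _ (a y)]
    linear_combination h1 - h2 - h4
  obtain rfl : x = p := sub_eq_zero.mp hxp
  refine ⟨p.2, fun y => ?_⟩
  have := hp y
  rwa [sub_self, inner_zero_left, zero_add] at this

/-! ### The space `H_a` seen through the square root. -/

variable (ha : IsAdmissible a)

theorem IsPosSqrt.exists_isometry (hs : IsPosSqrt s a) :
    ∃ V : HilbertRan a ha →ₗᵢ[ℂ] H, ∀ x : a.domain,
      V (Ran.of ha x : HilbertRan a ha) = s ⟨x, hs.domain_le x.2⟩ := by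
  let f : a.domain →ₗ[ℂ] H := s.toFun ∘ₗ Submodule.inclusion hs.domain_le
  have hf : ∀ x y, inner ℂ (f x) (f y) = inner ℂ (Ran.of ha x) (Ran.of ha y) := fun x y => by
    rw [Ran.inner_of]
    exact (hs.inner_apply x ⟨y, hs.domain_le y.2⟩).symm
  have hker : ∀ x y, Ran.of ha x = Ran.of ha y → f x = f y := fun x y h => by
    rw [← sub_eq_zero, ← map_sub, ← inner_self_eq_zero (𝕜 := ℂ), hf, map_sub, h, sub_self,
      inner_zero_left]
  have hpre : ∀ p, Ran.of ha (Ran.preim ha p) = p := fun p =>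
    Ran.incl_injective ha (Ran.map_preim ha p)
  let V₀ : Ran a ha →ₗ[ℂ] H :=
    { toFun := fun p => f (Ran.preim ha p)
      map_add' := fun p q => by
        rw [← map_add]
        exact hker _ _ (by rw [map_add, hpre, hpre, hpre])
      map_smul' := fun c p => by
        rw [RingHom.id_apply, ← map_smul]
        exact hker _ _ (by rw [map_smul, hpre, hpre]) }
  let V₁ : Ran a ha →ₗᵢ[ℂ] H := V₀.isometryOfInner fun p q => by
    change inner ℂ (f _) (f _) = _
    rw [hf, hpre, hpre]
  let V : HilbertRan a ha →L[ℂ] H :=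
    V₁.toContinuousLinearMap.extend
      (UniformSpace.Completion.toComplₗᵢ (𝕜 := ℂ) (E := Ran a ha)).toContinuousLinearMap
  have hV : ∀ p : Ran a ha, V p = V₁ p := fun p =>
    ContinuousLinearMap.extend_eq _ UniformSpace.Completion.denseRange_coe
      (UniformSpace.Completion.isUniformInducing_coe _) p
  refine ⟨⟨V.toLinearMap, fun u => ?_⟩, fun x => (hV _).trans (hker _ _ (hpre _))⟩
  change ‖V u‖ = ‖u‖
  induction u using UniformSpace.Completion.induction_on with
  | hp => exact isClosed_eq (by fun_prop) (by fun_prop)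
  | ih p => rw [hV, V₁.norm_map, UniformSpace.Completion.norm_coe]

/-- The vector `u` of `H_a` represents the functional `p ↦ (x, p)` on `ran a`, that is, `u` is the
image of `x` under the adjoint of the inclusion of `ran a` into `H`. -/
def Represents (x : H) (u : HilbertRan a ha) : Prop :=
  ∀ y : a.domain, inner ℂ u (Ran.of ha y : HilbertRan a ha) = inner ℂ x (a y)

/-- The representing vector is `V* (s x)`, since `(s x, V (a y)) = (s x, s y) = (x, a y)`. -/
theorem IsPosSqrt.exists_represents (hs : IsPosSqrt s a) {x : H} (hx : x ∈ s.domain) :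
    ∃ u, Represents ha x u := by
  obtain ⟨V, hV⟩ := hs.exists_isometry ha
  refine ⟨ContinuousLinearMap.adjoint V.toContinuousLinearMap (s ⟨x, hx⟩), fun y => ?_⟩
  rw [ContinuousLinearMap.adjoint_inner_left, LinearIsometry.coe_toContinuousLinearMap, hV,
    ← inner_conj_symm, ← hs.inner_apply y ⟨x, hx⟩, inner_conj_symm]

variable {ha}

theorem IsPosSqrt.mem_domain_of_represents (hs : IsPosSqrt s a) {x : H} {u : HilbertRan a ha}
    (h : Represents ha x u) : x ∈ s.domain := by
  obtain ⟨V, hV⟩ := hs.exists_isometry ha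
  exact (hs.mem_domain_of_forall_inner (v := V u) fun y => by
    rw [← hV, V.inner_map_map, h y]).1

/-- It is not necessary to know that `V u = s x`: the difference is orthogonal to `ran s`, hence by
density of `ran a` in `H_a` also to `ran V`. One replaces `V u` by `s x` and then `V v` by `s y`. -/
theorem IsPosSqrt.inner_eq_of_represents (hs : IsPosSqrt s a) {x y : s.domain}
    {u v : HilbertRan a ha} (hu : Represents ha x u) (hv : Represents ha y v) :
    inner ℂ u v = inner ℂ (s x) (s y) := by
  obtain ⟨V, hV⟩ := hs.exists_isometry ha
  have key : ∀ {x : s.domain} {u : HilbertRan a ha}, Represents ha x u →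
      ∀ y : s.domain, inner ℂ (V u) (s y) = inner ℂ (s x) (s y) := by
    intro x u hu y
    obtain ⟨hx, h⟩ := hs.mem_domain_of_forall_inner (v := V u) (x := x) fun y => by
      rw [← hV, V.inner_map_map, hu y]
    rw [← sub_eq_zero, ← inner_sub_left]
    exact h y
  -- By continuity it suffices to take `w ∈ ran a`, where `V w ∈ ran s`.
  have hw : ∀ w, inner ℂ (V u) (V w) = inner ℂ (s x) (V w) := by
    intro w
    induction w using UniformSpace.Completion.induction_on with
    | hp => exact isClosed_eq (by fun_prop) (by fun_prop)
    | ih p =>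
      obtain ⟨z, rfl⟩ : ∃ z, Ran.of ha z = p :=
        ⟨_, Ran.incl_injective ha (Ran.map_preim ha p)⟩
      rw [hV]
      exact key hu _
  rw [← V.inner_map_map, hw, ← inner_conj_symm, key hv x, inner_conj_symm]

end Form

/-! ### The adjoint of `J` -/

section Main

variable {a b : H →ₗ.[ℂ] H} (ha : IsAdmissible a) (hb : IsAdmissible b)

theorem dense_opJ_domain :
    Dense ((opJ ha hb).domain : Set (WithLp 2 (HilbertRan a ha × HilbertRan b hb))) := by
  have h : DenseRange (sumEmb ha hb) :=
    (WithLp.linearEquiv 2 ℂ (HilbertRan a ha × HilbertRan b hb)).symm.surjective.denseRange.comp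
      (UniformSpace.Completion.denseRange_coe.prodMap UniformSpace.Completion.denseRange_coe)
      (WithLp.prod_continuous_toLp 2 _ _)
  rwa [DenseRange, ← LinearMap.coe_range] at h

/-- Testing against `a y ⊕ 0` and `0 ⊕ b z` separates the two components. -/
theorem mem_opJ_adjoint_graph_iff (x : H) (u : WithLp 2 (HilbertRan a ha × HilbertRan b hb)) :
    (x, u) ∈ (opJ ha hb)†.graph ↔ Represents ha x u.fst ∧ Represents hb x u.snd := by
  rw [mem_adjoint_graph_iff (dense_opJ_domain ha hb)]
  constructor
  · intro h
    have h' : ∀ (y : a.domain) (z : b.domain), inner ℂ u.fst (Ran.of ha y : HilbertRan a ha) +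
        inner ℂ u.snd (Ran.of hb z : HilbertRan b hb) = inner ℂ x (a y + b z) := fun y z => by
      rw [← opJ_apply ha hb y z, ← h]
      rfl
    constructor
    · intro y
      simpa [UniformSpace.Completion.coe_zero] using h' y 0
    · intro z
      simpa [UniformSpace.Completion.coe_zero] using h' 0 z
  · rintro ⟨h, h'⟩ ⟨_, ⟨p, q⟩, rfl⟩
    obtain ⟨y, rfl⟩ : ∃ y, Ran.of ha y = p := ⟨_, Ran.incl_injective ha (Ran.map_preim ha p)⟩
    obtain ⟨z, rfl⟩ : ∃ z, Ran.of hb z = q := ⟨_, Ran.incl_injective hb (Ran.map_preim hb q)⟩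
    rw [opJ_apply, inner_add_right, ← h, ← h']
    rfl

variable [CompleteSpace H] {ha hb} {s t : H →ₗ.[ℂ] H}

theorem opJ_adjoint_domain (hs : IsPosSqrt s a) (ht : IsPosSqrt t b) :
    (opJ ha hb)†.domain = s.domain ⊓ t.domain := by
  ext x
  constructor
  · intro hx
    have h := (mem_opJ_adjoint_graph_iff ha hb _ _).mp ((opJ ha hb)†.mem_graph ⟨x, hx⟩)
    exact ⟨hs.mem_domain_of_represents h.1, ht.mem_domain_of_represents h.2⟩
  · rintro ⟨hx, hx'⟩
    obtain ⟨u, hu⟩ := hs.exists_represents ha hx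
    obtain ⟨v, hv⟩ := ht.exists_represents hb hx'
    exact LinearPMap.mem_domain_of_mem_graph
      ((mem_opJ_adjoint_graph_iff ha hb x (WithLp.toLp 2 (u, v))).mpr ⟨hu, hv⟩)

theorem inner_opJ_adjoint (hs : IsPosSqrt s a) (ht : IsPosSqrt t b)
    (x y : (opJ ha hb)†.domain) (hx : (x : H) ∈ s.domain ⊓ t.domain)
    (hy : (y : H) ∈ s.domain ⊓ t.domain) :
    inner ℂ ((opJ ha hb)† x) ((opJ ha hb)† y) =
      inner ℂ (s ⟨x, hx.1⟩) (s ⟨y, hy.1⟩) + inner ℂ (t ⟨x, hx.2⟩) (t ⟨y, hy.2⟩) := by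
  have h := (mem_opJ_adjoint_graph_iff ha hb _ _).mp ((opJ ha hb)†.mem_graph x)
  have h' := (mem_opJ_adjoint_graph_iff ha hb _ _).mp ((opJ ha hb)†.mem_graph y)
  rw [← hs.inner_eq_of_represents (x := ⟨x, hx.1⟩) (y := ⟨y, hy.1⟩) h.1 h'.1,
    ← ht.inner_eq_of_represents (x := ⟨x, hx.2⟩) (y := ⟨y, hy.2⟩) h.2 h'.2]
  rfl

end Main
end
end FormSum

/-! ### The form sum as `J** J*`. -/

open FormSum in
theorem theorem3 {H : Type*} [NormedAddCommGroup H] [InnerProductSpace ℂ H] [CompleteSpace H]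
    (a b : H →ₗ.[ℂ] H) (ha : FormSum.IsPosSelfAdjoint a) (hb : FormSum.IsPosSelfAdjoint b)
    (hdense : Dense (((FormSum.opSqrt a).domain ⊓ (FormSum.opSqrt b).domain : Submodule ℂ H) :
      Set H)) :
    FormSum.opJJ ha.isAdmissible hb.isAdmissible = FormSum.formSum a b ∧
      FormSum.IsPosSelfAdjoint (FormSum.formSum a b) := by
  have hs := ha.isPosSqrt_opSqrt
  have ht := hb.isPosSqrt_opSqrt
  have hJ := dense_opJ_domain ha.isAdmissible hb.isAdmissible
  have hdom := opJ_adjoint_domain (ha := ha.isAdmissible) (hb := hb.isAdmissible) hs ht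
  have hJd : Dense ((opJ ha.isAdmissible hb.isAdmissible).adjoint.domain : Set H) := by
    rwa [hdom]
  have heq : opJJ ha.isAdmissible hb.isAdmissible = formSum a b := by
    refine LinearPMap.eq_of_eq_graph (Submodule.ext ?_)
    rintro ⟨x, z⟩
    rw [opJJ, mem_opComp_graph, formSum, mem_formOperator_graph _ _ hdense]
    constructor
    · rintro ⟨u, hu, hz⟩
      obtain ⟨x, rfl, rfl⟩ := (LinearPMap.mem_graph_iff _).mp hu
      rw [mem_adjoint_graph_iff hJd] at hz
      have hx := hdom.le x.2
      refine ⟨hx, fun y => ?_⟩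
      have hy := hdom.ge y.2
      rw [hz ⟨y, hy⟩, inner_opJ_adjoint hs ht x ⟨y, hy⟩ hx y.2]
      rfl
    · rintro ⟨hx, h⟩
      refine ⟨_, LinearPMap.mem_graph _ ⟨x, hdom.ge hx⟩, ?_⟩
      rw [mem_adjoint_graph_iff hJd]
      intro y
      rw [inner_opJ_adjoint hs ht ⟨x, hdom.ge hx⟩ y hx (hdom.le y.2)]
      exact (h ⟨y, hdom.le y.2⟩).symm
  refine ⟨heq, ?_⟩
  rw [← heq]
  -- Von Neumann's theorem for `T = J*`, which is closed as an adjoint.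
  exact isPosSelfAdjoint_adjoint_comp_self (LinearPMap.adjoint_isClosed hJ) hJd
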